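/- **Theorem 5.1 (Rectifiability in CAT(0)-spaces).** Let $(X,d)$ be a complete CAT(0)-space: any two points are joined by a minimal geodesic $\gamma:[0,1]\to X$ (that is, $d(\gamma(s),\gamma(t))=|t-s|\,d(\gamma(0),\gamma(1))$), and for all $x,y,z\in X$ and every minimal geodesic $\gamma$ from $y$ to $z$ one has $d^2(x,\gamma(s))\le(1-s)d^2(x,y)+s\,d^2(x,z)-(1-s)s\,d^2(y,z)$ for $s\in[0,1]$. Let $\gamma_{xy}$ be the unique minimal geodesic from $x$ to $y$. The angle at $x$ of two nonconstant geodesics $\gamma,\eta$ from $x$ is $\angle_x(\gamma,\eta)=\lim_{s,t\downarrow0}\widetilde\angle[\gamma(s)\,x\,\eta(t)]$, where $\widetilde\angle[y\,x\,z]\in[0,\pi]$ is the Euclidean comparison angle, $\cos\widetilde\angle[y\,x\,z]=\frac{d^2(x,y)+d^2(x,z)-d^2(y,z)}{2d(x,y)d(x,z)}$. The space of directions $\Sigma_xX$ is the completion, with respect to $\angle_x$, of the set of nonconstant geodesics from $x$ modulo $\{\angle_x=0\}$; balls in it are open balls for $\angle_x$. Measures on $X$ and on $\Sigma_xX$ are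 Borel measures. Let $\Omega\subset X$ be bounded, $m\ge1$ an integer, $\varepsilon=\frac1{6m}$, and $a,b,\sigma>0$ real. Let $\mathbf V$ be a measure on $X$ and $\mathbf A_x$ $(x\in\Omega)$ a measure on $\Sigma_xX$, and suppose: 1. (Total boundedness) for every $x\in\Omega$, every $\Delta\subset\Sigma_xX$ with $\angle_x(\gamma,\eta)\ge\pi/3$ for all distinct $\gamma,\eta\in\Delta$ has at most $m$ elements; 2. (Area ratio) for every $x\in\Omega$ and $\gamma\in\Sigma_xX$, $\dfrac{\mathbf A_x\big(B_{\angle_x}(\gamma,2\arcsin(\varepsilon/2))\big)}{\mathbf A_x(\Sigma_xX)}\ge a$; 3. (Volume ratio) for every $z\in\Omega$ and $\gamma\in\Sigma_zX$, $\dfrac1{\mathbf V(\Omega)}\mathbf V\big(\{x\in X: 0<d(z,x)<\sigma,\ \angle_z(\gamma_{zx},\gamma)\ge\pi-2\arcsin(\varepsilon/2)\}\big)\ge b$. Let $\ell\in(0,\infty]$ and let $\xi:[0,\ell)\to X$ be a (not necessarily continuous) self-contracted curve, i.e. $d(\xi(t_2),\xi(t_3))\le d(\xi(t_1),\xi(t_3))$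 for all $0\le t_1\le t_2\le t_3<\ell$, such that the $\sigma$-neighborhood of its image $\Xi(0)=\xi([0,\ell))$ is contained in $\Omega$. Then the length $\mathsf L(\xi)=\sup\sum_i d(\xi(t_{i-1}),\xi(t_i))$ (supremum over all finite partitions $t_0<\dots<t_k$ in $[0,\ell)$) is finite, and $$\mathsf L(\xi)\le\frac{2}{ab\varepsilon}\,\mathsf W(\Xi(0))\le\frac{2}{ab\varepsilon}\operatorname{diam}(\Xi(0)).$$ Here, for bounded $\Xi\subset X$, $$\mathsf W(\Xi)=\frac1{\mathbf V(\Omega)}\int_\Omega\Big(\frac1{\mathbf A_x(\Sigma_xX)}\int_{\Sigma_xX}|\Pi_\gamma(\Xi)|\,\mathbf A_x(d\gamma)\Big)\mathbf V(dx)$$ is the mean width, where for $\gamma\in\Sigma_xX$ the set $\Pi_\gamma(\Xi)\subset\mathbb R$ is the closed convex hull of $\{p_\gamma(y):y\in\Xi\}$ with $p_\gamma(y)=d(x,y)\cos\angle_x(\gamma,\gamma_{xy})$ for $y\ne x$ and $p_\gamma(x)=0$, and $|\cdot|$ is Lebesgue measure. No measurability in $x$ of the inner average is assumed; if it is not measurable,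 the outer integral is the lower integral (the supremum of the integrals of the measurable functions below the integrand). -/

import Mathlib

open Set Filter MeasureTheory
open scoped Topology ENNReal

namespace SelfContractedCAT

section Geodesics

variable {X : Type*} [MetricSpace X]

/-- `γ : [0,1] → X` is a minimal geodesic from `x` to `y` (continuity is automatic). -/
structure IsMinGeodesic (γ : unitInterval → X) (x y : X) : Prop where
  source : γ 0 = x
  target : γ 1 = y
  dist_eq : ∀ s t : unitInterval, dist (γ s) (γ t) = |(t : ℝ) - s| * dist x y

/-- The Euclidean comparison angle at `x` of the triangle with vertices `y, x, z`,
a number in `[0, π]`. -/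
noncomputable def cmpAngle (y x z : X) : ℝ :=
  Real.arccos ((dist x y ^ 2 + dist x z ^ 2 - dist y z ^ 2) / (2 * dist x y * dist x z))

/-- A nonconstant minimal geodesic `[0,1] → X` emanating from `x`. -/
structure GeodesicFrom (x : X) where
  toFun : unitInterval → X
  isMinGeodesic : IsMinGeodesic toFun x (toFun 1)
  endpoint_ne : toFun 1 ≠ x

/-- The angle at `x` between two geodesics emanating from `x`: the limit of the comparison angles
as both parameters tend to `0` from the right. It is written as an upper limit, so that it makes
sense in every metric space; in a CAT(0)-space the limit exists (`tendsto_angle` below). -/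
noncomputable def angle {x : X} (γ η : GeodesicFrom x) : ℝ :=
  limsup (fun p : unitInterval × unitInterval => cmpAngle (γ.toFun p.1) x (η.toFun p.2)) (𝓝[>] (0 : unitInterval) ×ˢ 𝓝[>] (0 : unitInterval))

end Geodesics

/-- A geodesic metric space is a CAT(0)-space if the squared distance function from every point
satisfies the comparison inequality along every minimal geodesic. -/
class CATZeroSpace (X : Type*) [MetricSpace X] : Prop where
  exists_geodesic : ∀ x y : X, ∃ γ : unitInterval → X, IsMinGeodesic γ x y
  comparison : ∀ (x y z : X) (γ : unitInterval → X), IsMinGeodesic γ y z → ∀ s : unitInterval,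
    dist x (γ s) ^ 2 ≤
      (1 - (s : ℝ)) * dist x y ^ 2 + s * dist x z ^ 2 - (1 - (s : ℝ)) * s * dist y z ^ 2

section AngleMetric

variable {X : Type*} [MetricSpace X]

instance : NeBot (𝓝[>] (0 : unitInterval)) :=
  nhdsGT_neBot_of_exists_gt ⟨1, zero_lt_one⟩

lemma cmpAngle_nonneg (y x z : X) : 0 ≤ cmpAngle y x z := Real.arccos_nonneg _

lemma cmpAngle_le_pi (y x z : X) : cmpAngle y x z ≤ Real.pi := Real.arccos_le_pi _

lemma cmpAngle_comm (y x z : X) : cmpAngle y x z = cmpAngle z x y := by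
  unfold cmpAngle
  rw [dist_comm y z]
  congr 1
  ring

lemma isBounded_le_cmpAngle {x : X} (γ η : GeodesicFrom x) (l : Filter (unitInterval × unitInterval)) :
    IsBoundedUnder (· ≤ ·) l (fun p : unitInterval × unitInterval => cmpAngle (γ.toFun p.1) x (η.toFun p.2)) :=
  isBoundedUnder_of ⟨Real.pi, fun _ => cmpAngle_le_pi _ _ _⟩

lemma isBounded_ge_cmpAngle {x : X} (γ η : GeodesicFrom x) (l : Filter (unitInterval × unitInterval)) :
    IsBoundedUnder (· ≥ ·) l (fun p : unitInterval × unitInterval => cmpAngle (γ.toFun p.1) x (η.toFun p.2)) :=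
  isBoundedUnder_of ⟨0, fun _ => cmpAngle_nonneg _ _ _⟩

namespace GeodesicFrom

/-- The length of a geodesic. -/
noncomputable def len {x : X} (γ : GeodesicFrom x) : ℝ := dist x (γ.toFun 1)

lemma len_pos {x : X} (γ : GeodesicFrom x) : 0 < γ.len := dist_pos.2 γ.endpoint_ne.symm

lemma dist_start {x : X} (γ : GeodesicFrom x) (s : unitInterval) :
    dist x (γ.toFun s) = s * γ.len := by
  have h := γ.isMinGeodesic.dist_eq 0 s
  rw [γ.isMinGeodesic.source] at h
  rw [h]
  simp [len, abs_of_nonneg s.2.1]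

end GeodesicFrom

lemma pos_eventually : ∀ᶠ p : unitInterval × unitInterval in 𝓝[>] (0 : unitInterval) ×ˢ 𝓝[>] (0 : unitInterval), 0 < p.1 ∧ 0 < p.2 :=
  Eventually.prod_mk self_mem_nhdsWithin self_mem_nhdsWithin

lemma angle_self {x : X} (γ : GeodesicFrom x) : angle γ γ = 0 := by
  unfold angle
  have h : (fun p : unitInterval × unitInterval => cmpAngle (γ.toFun p.1) x (γ.toFun p.2))
      =ᶠ[𝓝[>] (0 : unitInterval) ×ˢ 𝓝[>] (0 : unitInterval)] fun _ => (0 : ℝ) := by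
    filter_upwards [pos_eventually] with p hp
    have h1 : (0 : ℝ) < p.1 := hp.1
    have h2 : (0 : ℝ) < p.2 := hp.2
    have hl := γ.len_pos
    unfold cmpAngle
    rw [γ.dist_start, γ.dist_start, γ.isMinGeodesic.dist_eq]
    change Real.arccos ((_ + _ - (_ * γ.len) ^ 2) / _) = 0
    rw [mul_pow |_|, sq_abs, Real.arccos_eq_zero, le_div_iff₀ (by positivity)]
    apply le_of_eq
    ring
  rw [limsup_congr h]
  exact limsup_const 0

lemma angle_comm {x : X} (γ η : GeodesicFrom x) : angle γ η = angle η γ := by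
  unfold angle
  conv_rhs => rw [prod_comm]
  rw [limsup, limsup, map_map]
  congr 2
  funext p
  exact cmpAngle_comm _ _ _

/-- A point on the side of a Euclidean triangle that splits the opposite angle. -/
lemma exists_split {p q α β : ℝ} (hp : 0 < p) (hq : 0 < q) (hα : 0 < α) (hβ : 0 < β)
    (hαβ : α + β < Real.pi) : ∃ r u v w : ℝ, 0 < r ∧ r ≤ max p q ∧ 0 ≤ u ∧ 0 ≤ v ∧ 0 ≤ w ∧
      u ^ 2 = p ^ 2 + r ^ 2 - 2 * p * r * Real.cos α ∧
      v ^ 2 = r ^ 2 + q ^ 2 - 2 * r * q * Real.cos β ∧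
      w ^ 2 = p ^ 2 + q ^ 2 - 2 * p * q * Real.cos (α + β) ∧ u + v = w := by
  have sα : 0 < Real.sin α := Real.sin_pos_of_pos_of_lt_pi hα (by linarith)
  have sβ : 0 < Real.sin β := Real.sin_pos_of_pos_of_lt_pi hβ (by linarith)
  have sαβ : 0 < Real.sin (α + β) := Real.sin_pos_of_pos_of_lt_pi (by linarith) hαβ
  have hD : 0 < p * Real.sin α + q * Real.sin β := by positivity
  have hα2 := Real.sin_sq_add_cos_sq α
  have hβ2 := Real.sin_sq_add_cos_sq β
  have hw2 : 0 ≤ p ^ 2 + q ^ 2 - 2 * p * q * Real.cos (α + β) := by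
    nlinarith [Real.cos_le_one (α + β), sq_nonneg (p - q), mul_pos hp hq]
  set w := Real.sqrt (p ^ 2 + q ^ 2 - 2 * p * q * Real.cos (α + β)) with hw
  have hw0 : 0 ≤ w := Real.sqrt_nonneg _
  have hwsq : w ^ 2 = p ^ 2 + q ^ 2 - 2 * p * q * Real.cos (α + β) := Real.sq_sqrt hw2
  set D := p * Real.sin α + q * Real.sin β with hDdef
  have hr : p * q * Real.sin (α + β) / D
      = (q * Real.sin β / D) * (p * Real.cos α) + (p * Real.sin α / D) * (q * Real.cos β) := by
    rw [Real.sin_add]; field_simp; ring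
  have hlam : q * Real.sin β / D + p * Real.sin α / D = 1 := by
    field_simp; rw [hDdef]; ring
  refine ⟨p * q * Real.sin (α + β) / D, p * Real.sin α / D * w, q * Real.sin β / D * w, w,
    by positivity, ?_, by positivity, by positivity, hw0, ?_, ?_, hwsq, ?_⟩
  · rw [hr]
    have h1 : p * Real.cos α ≤ max p q :=
      le_trans (by nlinarith [Real.cos_le_one α]) (le_max_left _ _)
    have h2 : q * Real.cos β ≤ max p q :=
      le_trans (by nlinarith [Real.cos_le_one β]) (le_max_right _ _)
    have l1 : 0 ≤ q * Real.sin β / D := by positivity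
    have l2 : 0 ≤ p * Real.sin α / D := by positivity
    calc _ ≤ (q * Real.sin β / D) * max p q + (p * Real.sin α / D) * max p q := by gcongr
      _ = max p q := by rw [← add_mul, hlam, one_mul]
  · rw [mul_pow, hwsq, Real.cos_add, Real.sin_add]
    field_simp
    rw [hDdef]
    have e1 : Real.cos α ^ 2 = 1 - Real.sin α ^ 2 := by linarith
    have e2 : Real.cos β ^ 2 = 1 - Real.sin β ^ 2 := by linarith
    ring_nf
    rw [e1, e2]
    ring_nf
  · rw [mul_pow, hwsq, Real.cos_add, Real.sin_add]
    field_simp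
    rw [hDdef]
    have e1 : Real.cos α ^ 2 = 1 - Real.sin α ^ 2 := by linarith
    have e2 : Real.cos β ^ 2 = 1 - Real.sin β ^ 2 := by linarith
    ring_nf
    rw [e1, e2]
    ring_nf
  · rw [← add_mul, add_comm, hlam, one_mul]

lemma dist_lt_of_cmpAngle_lt {x y z : X} {α u : ℝ} (hy : 0 < dist x y) (hz : 0 < dist x z)
    (hα : α ≤ Real.pi) (hu : 0 ≤ u) (h : cmpAngle y x z < α)
    (hu2 : u ^ 2 = dist x y ^ 2 + dist x z ^ 2 - 2 * dist x y * dist x z * Real.cos α) :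
    dist y z < u := by
  have hα0 : 0 ≤ α := (cmpAngle_nonneg y x z).trans h.le
  have h1 : Real.cos α <
      (dist x y ^ 2 + dist x z ^ 2 - dist y z ^ 2) / (2 * dist x y * dist x z) := by
    by_contra hc
    have := Real.arccos_le_arccos (not_lt.1 hc)
    rw [Real.arccos_cos hα0 hα] at this
    exact absurd h (not_lt.2 this)
  rw [lt_div_iff₀ (by positivity)] at h1
  exact lt_of_pow_lt_pow_left₀ 2 hu (by nlinarith)

lemma lt_dist_of_lt_cmpAngle {x y z : X} {α w : ℝ} (hy : 0 < dist x y) (hz : 0 < dist x z)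
    (hα : 0 ≤ α) (h : α < cmpAngle y x z)
    (hw2 : w ^ 2 = dist x y ^ 2 + dist x z ^ 2 - 2 * dist x y * dist x z * Real.cos α) :
    w < dist y z := by
  have hα1 : α ≤ Real.pi := h.le.trans (cmpAngle_le_pi y x z)
  have h1 : (dist x y ^ 2 + dist x z ^ 2 - dist y z ^ 2) / (2 * dist x y * dist x z)
      < Real.cos α := by
    by_contra hc
    have := Real.arccos_le_arccos (not_lt.1 hc)
    rw [Real.arccos_cos hα hα1] at this
    exact absurd h (not_lt.2 this)
  rw [div_lt_iff₀ (by positivity)] at h1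
  exact lt_of_pow_lt_pow_left₀ 2 dist_nonneg (by nlinarith)

lemma eventually_lt_zero_right {c : ℝ} (hc : 0 < c) : ∀ᶠ s : unitInterval in 𝓝[>] (0 : unitInterval), (s : ℝ) < c := by
  apply mem_nhdsWithin_of_mem_nhds
  exact continuous_subtype_val.continuousAt.eventually_lt continuousAt_const (by simpa using hc)

lemma exists_pos_of_eventually {P : unitInterval → Prop} (h : ∀ᶠ s in 𝓝[>] (0 : unitInterval), P s) :
    ∃ ρ : ℝ, 0 < ρ ∧ ρ ≤ 1 ∧ ∀ s : unitInterval, 0 < (s : ℝ) → (s : ℝ) < ρ → P s := by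
  obtain ⟨c, hc, hP⟩ := (mem_nhdsGT_iff_exists_Ioo_subset' (zero_lt_one (α := unitInterval))).1 h
  exact ⟨c, hc, c.2.2, fun s h0 h1 => hP ⟨h0, h1⟩⟩

/-- The triangle inequality for angles. -/
lemma angle_triangle {x : X} (γ η ζ : GeodesicFrom x) : angle γ ζ ≤ angle γ η + angle η ζ := by
  by_contra! hcon
  obtain ⟨δ, hδ, hδ'⟩ : ∃ δ : ℝ, 0 < δ ∧ angle γ η + angle η ζ + 3 * δ < angle γ ζ :=
    ⟨(angle γ ζ - (angle γ η + angle η ζ)) / 4, by linarith, by linarith⟩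
  have nn : ∀ a b : GeodesicFrom x, 0 ≤ angle a b := fun a b =>
    le_limsup_of_frequently_le (Frequently.of_forall fun _ => cmpAngle_nonneg _ _ _)
      (isBounded_le_cmpAngle a b _)
  have hA := nn γ η
  have hB := nn η ζ
  have ev1 : ∀ᶠ p : unitInterval × unitInterval in 𝓝[>] (0 : unitInterval) ×ˢ 𝓝[>] (0 : unitInterval),
      cmpAngle (γ.toFun p.1) x (η.toFun p.2) < angle γ η + δ :=
    eventually_lt_of_limsup_lt (lt_add_of_pos_right _ hδ) (isBounded_le_cmpAngle γ η _)
  have ev2 : ∀ᶠ p : unitInterval × unitInterval in 𝓝[>] (0 : unitInterval) ×ˢ 𝓝[>] (0 : unitInterval),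
      cmpAngle (η.toFun p.1) x (ζ.toFun p.2) < angle η ζ + δ :=
    eventually_lt_of_limsup_lt (lt_add_of_pos_right _ hδ) (isBounded_le_cmpAngle η ζ _)
  have fr : ∃ᶠ p : unitInterval × unitInterval in 𝓝[>] (0 : unitInterval) ×ˢ 𝓝[>] (0 : unitInterval),
      angle γ ζ - δ < cmpAngle (γ.toFun p.1) x (ζ.toFun p.2) :=
    frequently_lt_of_lt_limsup (isBounded_ge_cmpAngle γ ζ _).isCoboundedUnder_le
      (sub_lt_self _ hδ)
  obtain ⟨P1, hP1, Q1, hQ1, H1⟩ := eventually_prod_iff.1 ev1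
  obtain ⟨P2, hP2, Q2, hQ2, H2⟩ := eventually_prod_iff.1 ev2
  obtain ⟨ρ, hρ, hρ1, hη⟩ := exists_pos_of_eventually (hQ1.and hP2)
  have lγ := γ.len_pos
  have lη := η.len_pos
  have lζ := ζ.len_pos
  have ev3 := Eventually.prod_mk
    (hP1.and (eventually_lt_zero_right (c := ρ * η.len / γ.len) (by positivity)))
    (hQ2.and (eventually_lt_zero_right (c := ρ * η.len / ζ.len) (by positivity)))
  obtain ⟨⟨s, t⟩, hst, ⟨⟨hs1, hs2⟩, ht1, ht2⟩, hs0, ht0⟩ :=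
    (fr.and_eventually (ev3.and pos_eventually)).exists
  simp only at hst hs1 hs2 ht1 ht2 hs0 ht0
  have hs0' : (0 : ℝ) < s := hs0
  have ht0' : (0 : ℝ) < t := ht0
  rw [lt_div_iff₀ lγ] at hs2
  rw [lt_div_iff₀ lζ] at ht2
  have hpi := hst.trans_le (cmpAngle_le_pi _ _ _)
  have dγ := γ.dist_start s
  have dζ := ζ.dist_start t
  obtain ⟨r, u, v, w, hr, hrm, hu, hv, hw, hu2, hv2, hw2, huvw⟩ :=
    exists_split (p := s * γ.len) (q := t * ζ.len) (α := angle γ η + δ) (β := angle η ζ + δ)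
      (by positivity) (by positivity) (by linarith) (by linarith) (by linarith)
  have hr' : r < ρ * η.len := hrm.trans_lt (max_lt hs2 ht2)
  have hrρ : r / η.len < ρ := by rwa [div_lt_iff₀ lη]
  have hr0 : 0 < r / η.len := by positivity
  let c : unitInterval := ⟨r / η.len, hr0.le, hrρ.le.trans hρ1⟩
  have dη : dist x (η.toFun c) = r := by
    rw [η.dist_start]
    exact div_mul_cancel₀ r lη.ne'
  obtain ⟨hc1, hc2⟩ := hη c hr0 hrρ
  have k1 : dist (γ.toFun s) (η.toFun c) < u :=
    dist_lt_of_cmpAngle_lt (by rw [dγ]; positivity) (by rw [dη]; exact hr) (by linarith) hu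
      (H1 hs1 hc1) (by rw [dγ, dη, hu2])
  have k2 : dist (η.toFun c) (ζ.toFun t) < v :=
    dist_lt_of_cmpAngle_lt (by rw [dη]; exact hr) (by rw [dζ]; positivity) (by linarith) hv
      (H2 hc2 ht1) (by rw [dζ, dη, hv2])
  have k3 : w < dist (γ.toFun s) (ζ.toFun t) :=
    lt_dist_of_lt_cmpAngle (α := angle γ η + δ + (angle η ζ + δ)) (by rw [dγ]; positivity)
      (by rw [dζ]; positivity) (by linarith) (lt_of_le_of_lt (by linarith) hst)
      (by rw [dγ, dζ, hw2])
  have := dist_triangle (γ.toFun s) (η.toFun c) (ζ.toFun t)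
  linarith

/-- The angle as a pseudo-distance on the nonconstant geodesics emanating from `x`. -/
noncomputable instance (x : X) : PseudoMetricSpace (GeodesicFrom x) where
  dist := angle
  dist_self := angle_self
  dist_comm := angle_comm
  dist_triangle := angle_triangle

/-- The space of directions at `x`: the completion, with respect to the angle, of the quotient of
the set of nonconstant geodesics emanating from `x` by the relation of having angle `0`. Its
distance function is the extended angle. -/
abbrev SpaceOfDirections (x : X) : Type _ := UniformSpace.Completion (GeodesicFrom x)

noncomputable instance (x : X) : MeasurableSpace (SpaceOfDirections x) := borel _

instance (x : X) : BorelSpace (SpaceOfDirections x) := ⟨rfl⟩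

end AngleMetric

section Directions

variable {X : Type*} [MetricSpace X] [CATZeroSpace X]

/-- In a CAT(0)-space the comparison angles are monotone in the first parameter. -/
lemma cmpAngle_mono_left {x : X} (γ : GeodesicFrom x) (z : X) (hz : z ≠ x) {s t : unitInterval}
    (hs : 0 < (s : ℝ)) (hst : (s : ℝ) ≤ t) :
    cmpAngle (γ.toFun s) x z ≤ cmpAngle (γ.toFun t) x z := by
  have ht : 0 < (t : ℝ) := hs.trans_le hst
  have hl := γ.len_pos
  have hxz : 0 < dist x z := dist_pos.2 hz.symm
  let r : unitInterval := ⟨(s : ℝ) / t, by positivity, by rwa [div_le_one ht]⟩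
  have hrt : r * t = s := Subtype.ext (div_mul_cancel₀ (s : ℝ) ht.ne')
  have hg : IsMinGeodesic (fun u : unitInterval => γ.toFun (u * t)) x (γ.toFun t) := by
    refine ⟨by simpa using γ.isMinGeodesic.source, by simp, fun u v => ?_⟩
    rw [γ.isMinGeodesic.dist_eq, γ.dist_start t]
    simp only [Set.Icc.coe_mul, GeodesicFrom.len]
    rw [← sub_mul, abs_mul, abs_of_pos ht, mul_assoc]
  have h := CATZeroSpace.comparison z x (γ.toFun t) _ hg r
  simp only [hrt] at h
  have hr : (r : ℝ) = s / t := rfl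
  rw [γ.dist_start, dist_comm z, dist_comm z, dist_comm z, hr] at h
  unfold cmpAngle
  apply Real.arccos_le_arccos
  rw [γ.dist_start, γ.dist_start, div_le_div_iff₀ (by positivity) (by positivity)]
  field_simp at h ⊢
  nlinarith

/-- In a CAT(0)-space the limit that defines the angle exists. -/
lemma tendsto_angle {x : X} (γ η : GeodesicFrom x) :
    Tendsto (fun p : unitInterval × unitInterval => cmpAngle (γ.toFun p.1) x (η.toFun p.2))
      (𝓝[>] (0 : unitInterval) ×ˢ 𝓝[>] (0 : unitInterval)) (𝓝 (angle γ η)) := by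
  have ne : ∀ (ζ : GeodesicFrom x) (s : unitInterval), 0 < (s : ℝ) → ζ.toFun s ≠ x := by
    intro ζ s hs
    rw [ne_comm, ← dist_pos, ζ.dist_start]
    exact mul_pos hs ζ.len_pos
  refine tendsto_order.2 ⟨fun a ha => ?_, fun a ha =>
    eventually_lt_of_limsup_lt ha (isBounded_le_cmpAngle γ η _)⟩
  filter_upwards [pos_eventually] with p hp
  have hp1 : (0 : ℝ) < p.1 := hp.1
  have hp2 : (0 : ℝ) < p.2 := hp.2
  refine ha.trans_le (limsup_le_of_le (isBounded_ge_cmpAngle γ η _).isCoboundedUnder_le ?_)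
  filter_upwards [pos_eventually,
    Eventually.prod_mk (eventually_lt_zero_right hp1) (eventually_lt_zero_right hp2)] with q hq hqp
  have hq1 : (0 : ℝ) < q.1 := hq.1
  have hq2 : (0 : ℝ) < q.2 := hq.2
  refine (cmpAngle_mono_left γ _ (ne η _ hq2) hq1 hqp.1.le).trans ?_
  rw [cmpAngle_comm, cmpAngle_comm (γ.toFun p.1)]
  exact cmpAngle_mono_left η _ (ne γ _ hp1) hq2 hqp.2.le

/-- The (unique) minimal geodesic from `x` to `y ≠ x`. -/
noncomputable def geodesicTo (x y : X) (h : y ≠ x) : GeodesicFrom x where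
  toFun := (CATZeroSpace.exists_geodesic x y).choose
  isMinGeodesic := by
    have hg := (CATZeroSpace.exists_geodesic x y).choose_spec
    rw [hg.target]
    exact hg
  endpoint_ne := by
    rw [(CATZeroSpace.exists_geodesic x y).choose_spec.target]
    exact h

/-- The direction at `x` of the minimal geodesic from `x` to `y ≠ x`. -/
noncomputable def dir (x y : X) (h : y ≠ x) : SpaceOfDirections x :=
  (geodesicTo x y h : UniformSpace.Completion (GeodesicFrom x))

open Classical in
/-- The composition of the logarithm `y ↦ (direction from x to y, d(x,y))` into the tangent cone
at `x` with the projection `(η, s) ↦ s cos ∠(γ, η)` to the direction `γ`. -/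
noncomputable def projLog {x : X} (γ : SpaceOfDirections x) (y : X) : ℝ :=
  if h : y = x then 0 else dist x y * Real.cos (dist γ (dir x y h))

/-- The closed convex hull of the image of `S` under `projLog γ`. -/
noncomputable def hullProj {x : X} (γ : SpaceOfDirections x) (S : Set X) : Set ℝ :=
  closedConvexHull ℝ (projLog γ '' S)

/-- Total boundedness of the spaces of directions on `Ω`: at every point of `Ω`, a set of
directions with pairwise angles at least `π/3` has at most `m` elements. -/
def DirectionBound (Ω : Set X) (m : ℕ) : Prop :=
  ∀ x ∈ Ω, ∀ Δ : Set (SpaceOfDirections x),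
    (∀ γ ∈ Δ, ∀ η ∈ Δ, γ ≠ η → Real.pi / 3 ≤ dist γ η) → Δ.encard ≤ m

/-- The area ratio condition on `Ω` for the measures `A x` on the spaces of directions. In
`ℝ≥0∞` a lower bound `a > 0` forces the total measure to be positive and finite. -/
def AreaRatio (Ω : Set X) (ε a : ℝ) (A : ∀ x : X, Measure (SpaceOfDirections x)) : Prop :=
  ∀ x ∈ Ω, ∀ γ : SpaceOfDirections x,
    ENNReal.ofReal a ≤ A x (Metric.ball γ (2 * Real.arcsin (ε / 2))) / A x univ

/-- The points at distance less than `σ` from `z`, other than `z`, that lie from `z` in a direction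
almost opposite to `γ`. -/
def oppositeCone (ε σ : ℝ) {z : X} (γ : SpaceOfDirections z) : Set X :=
  {x | ∃ h : x ≠ z, dist z x < σ ∧ Real.pi - 2 * Real.arcsin (ε / 2) ≤ dist (dir z x h) γ}

/-- The volume ratio condition on `Ω` at scale `σ` for the measure `V`. -/
def VolumeRatio [MeasurableSpace X] (Ω : Set X) (ε σ b : ℝ) (V : Measure X) : Prop :=
  ∀ z ∈ Ω, ∀ γ : SpaceOfDirections z, ENNReal.ofReal b ≤ V (oppositeCone ε σ γ) / V Ω

/-- The mean width of `S`: the average over `x ∈ Ω` and over the directions `γ` at `x` of the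
length of the interval `hullProj γ S`. -/
noncomputable def meanWidth [MeasurableSpace X] (Ω : Set X)
    (A : ∀ x : X, Measure (SpaceOfDirections x)) (V : Measure X) (S : Set X) : ℝ≥0∞ :=
  (V Ω)⁻¹ * ∫⁻ x in Ω, (A x univ)⁻¹ * ∫⁻ γ, volume (hullProj γ S) ∂(A x) ∂V

end Directions

/-- A (not necessarily continuous) curve is self-contracted if `d(ξ(t₂), ξ(t₃)) ≤ d(ξ(t₁), ξ(t₃))`
for all parameters `t₁ ≤ t₂ ≤ t₃`. -/
def SelfContracted {T X : Type*} [Preorder T] [MetricSpace X] (ξ : T → X) : Prop :=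
  ∀ t₁ t₂ t₃ : T, t₁ ≤ t₂ → t₂ ≤ t₃ → dist (ξ t₂) (ξ t₃) ≤ dist (ξ t₁) (ξ t₃)

end SelfContractedCAT

open SelfContractedCAT

/-! The mean width of the tail `ξ '' Ici t` is nonincreasing in `t`, and between parameters `s ≤ t`
it drops by at least `a * b * ε / 2` times `dist (ξ s) (ξ t)`. Summing over a partition telescopes
(`eVariationOn_le_of_drop`), so the length is at most `2 / (a * b * ε)` times the initial mean
width, which is at most the diameter because `projLog γ` is 1-Lipschitz.

For the drop (`meanWidth_drop`), put `p = ξ s`, `q = ξ t` and let `S` be the tail from `t`.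
Self-contraction makes all directions from `p` to `S` pairwise acute. A maximal `π/3`-separated
family of them has at most `m` members, and a direction `γ` maximizing the sum of the cosines of the
angles to this family satisfies `cos ≥ 1 / (2m) = 3ε` towards all of `S`
(`exists_central_direction`). This sum extends homogeneously to a concave function on the tangent
cone (`add_sum_cos_le`), which gives both the existence of the maximizer and its first variation.

If `x` lies from `p` almost opposite to `γ`, and `η` is a direction at `x` close to that of `p`, the
projection along `η` puts `p` below every `y ∈ S` by `ε * dist p y ≥ ε * dist p q / 2`
(`projLog_add_le`). Removing `p` thus shortens the projected interval by that amount; the two ratio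
hypotheses bound from below the proportion of such `η` and `x`. -/

namespace SelfContractedCAT

/-! ### Comparison triangles and points of a geodesic at given distance -/

section Comparison

variable {X : Type*} [MetricSpace X]

/-- The law of cosines for comparison angles. -/
lemma dist_sq_eq_cmpAngle {x y z : X} (hy : y ≠ x) (hz : z ≠ x) :
    dist y z ^ 2 =
      dist x y ^ 2 + dist x z ^ 2 - 2 * dist x y * dist x z * Real.cos (cmpAngle y x z) := by
  have h1 : 0 < dist x y := dist_pos.2 hy.symm
  have h2 : 0 < dist x z := dist_pos.2 hz.symm
  have t1 := dist_triangle_left y z x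
  have t2 := dist_triangle x y z
  have t3 := dist_triangle_right x y z
  have h0 : 0 ≤ dist y z := dist_nonneg
  unfold cmpAngle
  rw [Real.cos_arccos]
  · field_simp
    ring
  · rw [le_div_iff₀ (by positivity)]
    nlinarith
  · rw [div_le_iff₀ (by positivity)]
    nlinarith [mul_nonneg (sub_nonneg.2 (sub_le_iff_le_add'.2 t2))
      (add_nonneg h0 (sub_nonneg.2 t3))]

namespace GeodesicFrom

/-- The point of a geodesic at distance `r` from its start, for `0 ≤ r ≤ γ.len`. -/
noncomputable def pt {x : X} (γ : GeodesicFrom x) (r : ℝ) : X :=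
  γ.toFun (projIcc 0 1 zero_le_one (r / γ.len))

lemma coe_param {x : X} (γ : GeodesicFrom x) {r : ℝ} (h0 : 0 ≤ r) (h1 : r ≤ γ.len) :
    ((projIcc 0 1 zero_le_one (r / γ.len) : unitInterval) : ℝ) = r / γ.len := by
  rw [projIcc_of_mem zero_le_one ⟨div_nonneg h0 γ.len_pos.le, (div_le_one γ.len_pos).2 h1⟩]

lemma dist_pt {x : X} (γ : GeodesicFrom x) {r : ℝ} (h0 : 0 ≤ r) (h1 : r ≤ γ.len) :
    dist x (γ.pt r) = r := by
  rw [pt, γ.dist_start, γ.coe_param h0 h1, div_mul_cancel₀ _ γ.len_pos.ne']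

lemma tendsto_param {x : X} (γ : GeodesicFrom x) {α : ℝ} (hα : 0 < α) :
    Tendsto (fun s : ℝ => (projIcc 0 1 zero_le_one (α * s / γ.len) : unitInterval))
      (𝓝[>] 0) (𝓝[>] 0) := by
  refine tendsto_nhdsWithin_iff.2 ⟨?_, ?_⟩
  · have h : Continuous fun s : ℝ =>
        (projIcc 0 1 zero_le_one (α * s / γ.len) : unitInterval) := by
      exact continuous_projIcc.comp (by fun_prop)
    have h2 := (h.tendsto 0).mono_left (nhdsWithin_le_nhds (s := Ioi 0))
    convert h2 using 2
    rw [mul_zero, zero_div, projIcc_left]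
    rfl
  · filter_upwards [self_mem_nhdsWithin] with s hs
    have : 0 < α * s / γ.len := div_pos (mul_pos hα hs) γ.len_pos
    show (0 : ℝ) < max 0 (min 1 _)
    exact lt_max_of_lt_right (lt_min one_pos this)

end GeodesicFrom

lemma GeodesicFrom.eventually_dist_pt {x : X} (γ : GeodesicFrom x) {α : ℝ} (hα : 0 < α) :
    ∀ᶠ s : ℝ in 𝓝[>] 0, dist x (γ.pt (α * s)) = α * s := by
  filter_upwards [Ioo_mem_nhdsGT (div_pos γ.len_pos hα)] with s hs
  refine γ.dist_pt (mul_pos hα hs.1).le ?_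
  have := (lt_div_iff₀' hα).1 hs.2
  exact this.le

lemma angle_nonneg {x : X} (γ η : GeodesicFrom x) : 0 ≤ angle γ η :=
  dist_nonneg (x := γ) (y := η)

end Comparison

/-! ### First-order geometry at a point of a CAT(0)-space -/

section CATZero

variable {X : Type*} [MetricSpace X] [CATZeroSpace X]

/-- Comparison angles are monotone in each parameter, so their limit at `0` is a lower bound. -/
lemma angle_le_cmpAngle {x : X} (γ η : GeodesicFrom x) {s t : unitInterval}
    (hs : 0 < (s : ℝ)) (ht : 0 < (t : ℝ)) :
    angle γ η ≤ cmpAngle (γ.toFun s) x (η.toFun t) := by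
  have ne : ∀ (ζ : GeodesicFrom x) (s : unitInterval), 0 < (s : ℝ) → ζ.toFun s ≠ x := by
    intro ζ s hs
    rw [ne_comm, ← dist_pos, ζ.dist_start]
    exact mul_pos hs ζ.len_pos
  refine le_of_tendsto (tendsto_angle γ η) ?_
  filter_upwards [pos_eventually,
    Eventually.prod_mk (eventually_lt_zero_right hs) (eventually_lt_zero_right ht)] with q hq hqp
  have hq1 : (0 : ℝ) < q.1 := hq.1
  have hq2 : (0 : ℝ) < q.2 := hq.2
  refine (cmpAngle_mono_left γ _ (ne η _ hq2) hq1 hqp.1.le).trans ?_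
  rw [cmpAngle_comm, cmpAngle_comm (γ.toFun s)]
  exact cmpAngle_mono_left η _ (ne γ _ hs) hq2 hqp.2.le

/-- The law of cosines as an inequality in a CAT(0)-space. -/
lemma sub_dist_sq_le {x : X} (γ η : GeodesicFrom x) {s t : unitInterval}
    (hs : 0 < (s : ℝ)) (ht : 0 < (t : ℝ)) :
    dist x (γ.toFun s) ^ 2 + dist x (η.toFun t) ^ 2 - dist (γ.toFun s) (η.toFun t) ^ 2 ≤
      2 * dist x (γ.toFun s) * dist x (η.toFun t) * Real.cos (angle γ η) := by
  have ne : ∀ (ζ : GeodesicFrom x) (s : unitInterval), 0 < (s : ℝ) → ζ.toFun s ≠ x := by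
    intro ζ s hs
    rw [ne_comm, ← dist_pos, ζ.dist_start]
    exact mul_pos hs ζ.len_pos
  rw [dist_sq_eq_cmpAngle (ne γ s hs) (ne η t ht)]
  have h := Real.cos_le_cos_of_nonneg_of_le_pi (angle_nonneg γ η) (cmpAngle_le_pi _ _ _)
    (angle_le_cmpAngle γ η hs ht)
  have : 0 ≤ 2 * dist x (γ.toFun s) * dist x (η.toFun t) := by positivity
  nlinarith [mul_le_mul_of_nonneg_left h this]

@[simp] lemma geodesicTo_one {x y : X} (h : y ≠ x) : (geodesicTo x y h).toFun 1 = y :=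
  (CATZeroSpace.exists_geodesic x y).choose_spec.target

/-- The first order behaviour of the distance between two geodesics from the same point. -/
lemma tendsto_dist_pt_sq {x : X} (γ η : GeodesicFrom x) {α β : ℝ} (hα : 0 < α) (hβ : 0 < β) :
    Tendsto (fun s : ℝ => dist (γ.pt (α * s)) (η.pt (β * s)) ^ 2 / s ^ 2) (𝓝[>] 0)
      (𝓝 (α ^ 2 + β ^ 2 - 2 * α * β * Real.cos (angle γ η))) := by
  have h1 := (tendsto_angle γ η).comp ((γ.tendsto_param hα).prodMk (η.tendsto_param hβ))
  have h2 := ((Real.continuous_cos.tendsto _).comp h1).const_mul (2 * α * β)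
  refine (h2.const_sub (α ^ 2 + β ^ 2)).congr' ?_
  filter_upwards [γ.eventually_dist_pt hα, η.eventually_dist_pt hβ, self_mem_nhdsWithin]
    with s e1 e2 hs
  have hs' : (0 : ℝ) < s := hs
  have n1 : γ.pt (α * s) ≠ x := by rw [ne_comm, ← dist_pos, e1]; positivity
  have n2 : η.pt (β * s) ≠ x := by rw [ne_comm, ← dist_pos, e2]; positivity
  rw [dist_sq_eq_cmpAngle n1 n2, e1, e2]
  simp only [Function.comp, GeodesicFrom.pt]
  field_simp

/-- The comparison inequality at the midpoint. -/
lemma exists_midpoint (y z : X) : ∃ w : X, ∀ x : X,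
    dist x w ^ 2 ≤ dist x y ^ 2 / 2 + dist x z ^ 2 / 2 - dist y z ^ 2 / 4 := by
  obtain ⟨γ, hγ⟩ := CATZeroSpace.exists_geodesic y z
  refine ⟨γ ⟨1 / 2, by norm_num, by norm_num⟩, fun x => ?_⟩
  have := CATZeroSpace.comparison x y z γ hγ ⟨1 / 2, by norm_num, by norm_num⟩
  norm_num at this
  linarith

open Finset in
/-- If the sum of the cosines of the angles to finitely many geodesics `v i` is at most `M`, then
its homogeneous extension to the tangent cone is "superadditive". -/
lemma add_sum_cos_le {x : X} {ι : Type*} (S : Finset ι) (v : ι → GeodesicFrom x) {M : ℝ}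
    (hM0 : 0 ≤ M) (hM : ∀ ζ : GeodesicFrom x, ∑ i ∈ S, Real.cos (angle ζ (v i)) ≤ M)
    (γ η : GeodesicFrom x) {α β : ℝ} (hα : 0 < α) (hβ : 0 < β) :
    α * ∑ i ∈ S, Real.cos (angle γ (v i)) + β * ∑ i ∈ S, Real.cos (angle η (v i)) ≤
      M * Real.sqrt (α ^ 2 + β ^ 2 + 2 * α * β * Real.cos (angle γ η)) := by
  set N2 := α ^ 2 + β ^ 2 + 2 * α * β * Real.cos (angle γ η) with hN2
  set f := fun ζ : GeodesicFrom x => ∑ i ∈ S, Real.cos (angle ζ (v i)) with hf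
  -- `C` is the scale of the test points `(v i).pt (C * s)`. Letting `s → 0` blows up at `x`;
  -- letting `C → ∞` afterwards removes the quadratic error.
  have key : ∀ C : ℝ, 0 < C → α * f γ + β * f η - #S * N2 / (2 * C) ≤ M * √N2 := by
    intro C hC
    have hα2 : 0 < 2 * α := by positivity
    have hβ2 : 0 < 2 * β := by positivity
    have T := tendsto_dist_pt_sq γ η hα2 hβ2
    have lim1 : Tendsto (fun s : ℝ => ∑ i ∈ S, (C ^ 2
        - (dist ((v i).pt (C * s)) (γ.pt (2 * α * s)) ^ 2 / s ^ 2 / 2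
          + dist ((v i).pt (C * s)) (η.pt (2 * β * s)) ^ 2 / s ^ 2 / 2
          - dist (γ.pt (2 * α * s)) (η.pt (2 * β * s)) ^ 2 / s ^ 2 / 4))) (𝓝[>] 0)
        (𝓝 (∑ i ∈ S, (2 * C * (α * Real.cos (angle γ (v i)) + β * Real.cos (angle η (v i)))
          - N2))) := by
      refine tendsto_finsetSum _ fun i _ => ?_
      have h := ((((tendsto_dist_pt_sq (v i) γ hC hα2).div_const 2).add
        ((tendsto_dist_pt_sq (v i) η hC hβ2).div_const 2)).sub (T.div_const 4)).const_sub (C ^ 2)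
      convert h using 2
      rw [angle_comm (v i) γ, angle_comm (v i) η, hN2]
      ring
    have lim2 : Tendsto (fun s : ℝ => 2 * C * M * √((2 * α) ^ 2 / 2 + (2 * β) ^ 2 / 2
          - dist (γ.pt (2 * α * s)) (η.pt (2 * β * s)) ^ 2 / s ^ 2 / 4)) (𝓝[>] 0)
        (𝓝 (2 * C * M * √N2)) := by
      have h := (((Real.continuous_sqrt.tendsto _).comp
        ((T.div_const 4).const_sub ((2 * α) ^ 2 / 2 + (2 * β) ^ 2 / 2)))).const_mul (2 * C * M)
      have e : N2 = (2 * α) ^ 2 / 2 + (2 * β) ^ 2 / 2 - ((2 * α) ^ 2 + (2 * β) ^ 2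
          - 2 * (2 * α) * (2 * β) * Real.cos (angle γ η)) / 4 := by
        rw [hN2]
        ring
      rw [e]
      exact h
    have ev : ∀ᶠ s : ℝ in 𝓝[>] 0, ∀ i ∈ S, dist x ((v i).pt (C * s)) = C * s :=
      (eventually_all_finset S).2 fun i _ => (v i).eventually_dist_pt hC
    have ev' : ∀ᶠ s : ℝ in 𝓝[>] 0, ∀ i ∈ S,
        (0 : ℝ) < (projIcc 0 1 zero_le_one (C * s / (v i).len) : unitInterval) :=
      (eventually_all_finset S).2 fun i _ =>
        (((v i).tendsto_param hC).eventually self_mem_nhdsWithin).mono fun s hs => hs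
    have hle : ∑ i ∈ S, (2 * C * (α * Real.cos (angle γ (v i)) + β * Real.cos (angle η (v i)))
          - N2) ≤ 2 * C * M * √N2 := by
      refine le_of_tendsto_of_tendsto lim1 lim2 ?_
      filter_upwards [γ.eventually_dist_pt hα2, η.eventually_dist_pt hβ2, ev, ev',
        self_mem_nhdsWithin] with s e1 e2 e3 e4 hs
      have hs' : (0 : ℝ) < s := hs
      -- The midpoint stands for the sum of the tangent vectors `αγ` and `βη`, scaled by `s`; the
      -- factors `2` compensate for the halving. Its distance to `x` is bounded through the
      -- comparison inequality, and so are its distances to the test points.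
      obtain ⟨w, hw⟩ := exists_midpoint (γ.pt (2 * α * s)) (η.pt (2 * β * s))
      have hsum : ∑ i ∈ S, (dist x w ^ 2 + (C * s) ^ 2 - dist ((v i).pt (C * s)) w ^ 2)
          ≤ 2 * dist x w * (C * s) * M := by
        by_cases hwx : w = x
        · subst hwx
          refine le_of_eq_of_le (Finset.sum_eq_zero fun i hi => ?_) (by simp)
          rw [dist_comm ((v i).pt _) w, e3 i hi]
          simp
        · have hle1 : ∀ i ∈ S, dist x w ^ 2 + (C * s) ^ 2 - dist ((v i).pt (C * s)) w ^ 2 ≤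
              2 * dist x w * (C * s) * Real.cos (angle (geodesicTo x w hwx) (v i)) := by
            intro i hi
            have h := sub_dist_sq_le (geodesicTo x w hwx) (v i) (s := 1) one_pos (e4 i hi)
            rw [geodesicTo_one] at h
            change _ + dist x ((v i).pt (C * s)) ^ 2 - dist w ((v i).pt (C * s)) ^ 2 ≤
              _ * dist x ((v i).pt (C * s)) * _ at h
            rwa [e3 i hi, dist_comm w] at h
          refine (Finset.sum_le_sum hle1).trans ?_
          rw [← Finset.mul_sum]
          exact mul_le_mul_of_nonneg_left (hM _) (by positivity)
      have hxw : dist x w / s ≤ √((2 * α) ^ 2 / 2 + (2 * β) ^ 2 / 2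
          - dist (γ.pt (2 * α * s)) (η.pt (2 * β * s)) ^ 2 / s ^ 2 / 4) := by
        apply Real.le_sqrt_of_sq_le
        have := hw x
        rw [e1, e2] at this
        rw [div_pow, div_le_iff₀ (by positivity)]
        refine this.trans (le_of_eq ?_)
        field_simp
      have h3 : ∑ i ∈ S, (C ^ 2
        - (dist ((v i).pt (C * s)) (γ.pt (2 * α * s)) ^ 2 / s ^ 2 / 2
          + dist ((v i).pt (C * s)) (η.pt (2 * β * s)) ^ 2 / s ^ 2 / 2
          - dist (γ.pt (2 * α * s)) (η.pt (2 * β * s)) ^ 2 / s ^ 2 / 4))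
          ≤ (∑ i ∈ S, (dist x w ^ 2 + (C * s) ^ 2 - dist ((v i).pt (C * s)) w ^ 2)) / s ^ 2 := by
        rw [Finset.sum_div]
        refine Finset.sum_le_sum fun i _ => ?_
        rw [le_div_iff₀ (by positivity)]
        have := hw ((v i).pt (C * s))
        have e : (C ^ 2
        - (dist ((v i).pt (C * s)) (γ.pt (2 * α * s)) ^ 2 / s ^ 2 / 2
          + dist ((v i).pt (C * s)) (η.pt (2 * β * s)) ^ 2 / s ^ 2 / 2
          - dist (γ.pt (2 * α * s)) (η.pt (2 * β * s)) ^ 2 / s ^ 2 / 4)) * s ^ 2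
          = (C * s) ^ 2 - (dist ((v i).pt (C * s)) (γ.pt (2 * α * s)) ^ 2 / 2
          + dist ((v i).pt (C * s)) (η.pt (2 * β * s)) ^ 2 / 2
          - dist (γ.pt (2 * α * s)) (η.pt (2 * β * s)) ^ 2 / 4) := by
          field_simp
        rw [e]
        nlinarith [sq_nonneg (dist x w)]
      refine h3.trans ?_
      calc _ ≤ 2 * dist x w * (C * s) * M / s ^ 2 := by gcongr
        _ = 2 * C * M * (dist x w / s) := by field_simp
        _ ≤ _ := by gcongr
    rw [Finset.sum_sub_distrib, ← Finset.mul_sum, Finset.sum_add_distrib, ← Finset.mul_sum,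
      ← Finset.mul_sum, Finset.sum_const, nsmul_eq_mul] at hle
    change 2 * C * (α * f γ + β * f η) - #S * N2 ≤ _ at hle
    rw [sub_le_iff_le_add, ← sub_le_iff_le_add', le_div_iff₀ (by positivity)]
    linarith
  have lim : Tendsto (fun C : ℝ => α * f γ + β * f η - #S * N2 / (2 * C)) atTop
      (𝓝 (α * f γ + β * f η - 0)) :=
    (tendsto_const_nhds.div_atTop (tendsto_id.const_mul_atTop two_pos)).const_sub _
  rw [sub_zero] at lim
  exact le_of_tendsto lim ((eventually_gt_atTop 0).mono key)

end CATZero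

/-! ### Central directions by maximizing a sum of cosines -/

section Barycenter

variable {X : Type*} [MetricSpace X] {x : X}

lemma dist_directions_le_pi (γ η : SpaceOfDirections x) : dist γ η ≤ Real.pi := by
  refine UniformSpace.Completion.induction_on₂ γ η (isClosed_le (by fun_prop) (by fun_prop))
    fun γ η => ?_
  rw [UniformSpace.Completion.dist_eq]
  exact limsup_le_of_le (isBounded_ge_cmpAngle γ η _).isCoboundedUnder_le
    (Eventually.of_forall fun _ => cmpAngle_le_pi _ _ _)

/-- The sum of the cosines of the angles to finitely many geodesics. -/
noncomputable def sumCos (S : Finset (GeodesicFrom x)) (γ : SpaceOfDirections x) : ℝ :=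
  ∑ v ∈ S, Real.cos (dist γ v)

lemma continuous_sumCos (S : Finset (GeodesicFrom x)) : Continuous (sumCos S) := by
  unfold sumCos
  fun_prop

lemma sumCos_le_card (S : Finset (GeodesicFrom x)) (γ : SpaceOfDirections x) :
    sumCos S γ ≤ S.card := by
  have h := Finset.sum_le_card_nsmul S _ 1 fun v _ => Real.cos_le_one (dist γ v)
  rwa [nsmul_eq_mul, mul_one] at h

variable [CATZeroSpace X]

lemma add_sumCos_le (S : Finset (GeodesicFrom x)) {M : ℝ} (hM0 : 0 ≤ M)
    (hM : ∀ ζ, sumCos S ζ ≤ M) (γ η : SpaceOfDirections x) {α β : ℝ} (hα : 0 < α) (hβ : 0 < β) :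
    α * sumCos S γ + β * sumCos S η ≤
      M * √(α ^ 2 + β ^ 2 + 2 * α * β * Real.cos (dist γ η)) := by
  have hc := continuous_sumCos S
  refine UniformSpace.Completion.induction_on₂ γ η
    (isClosed_le (by fun_prop) (by fun_prop)) fun γ η => ?_
  have e : ∀ ζ : GeodesicFrom x, sumCos S ζ = ∑ v ∈ S, Real.cos (angle ζ v) := fun ζ =>
    Finset.sum_congr rfl fun v _ => by rw [UniformSpace.Completion.dist_eq]; rfl
  rw [UniformSpace.Completion.dist_eq, e, e]
  exact add_sum_cos_le S id hM0 (fun ζ => by simpa only [e, id] using hM ζ) γ η hα hβ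

lemma tendsto_one_div_add_two : Tendsto (fun n : ℕ => 1 / ((n : ℝ) + 2)) atTop (𝓝 0) :=
  tendsto_const_nhds.div_atTop
    (tendsto_atTop_add_const_right _ _ tendsto_natCast_atTop_atTop)

/-- The function `sumCos S` attains its maximum if it is somewhere positive. -/
lemma exists_max_sumCos (S : Finset (GeodesicFrom x)) (hS : ∃ η, 0 < sumCos S η) :
    ∃ γ, ∀ ζ, sumCos S ζ ≤ sumCos S γ := by
  have bdd : BddAbove (range (sumCos S)) := ⟨S.card, by rintro _ ⟨ζ, rfl⟩; exact sumCos_le_card S ζ⟩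
  set M := ⨆ ζ, sumCos S ζ with hMdef
  have hM : ∀ ζ, sumCos S ζ ≤ M := le_ciSup bdd
  obtain ⟨η₀, hη₀⟩ := hS
  have hM0 : 0 < M := hη₀.trans_le (hM η₀)
  have : Nonempty (SpaceOfDirections x) := ⟨η₀⟩
  -- The shift is `2` rather than `1` so that the relative defect is below `1` already at `n = 0`;
  -- then `2 - 2δ` is positive and may be squared below.
  have ex : ∀ n : ℕ, ∃ γ, M - M / (n + 2) < sumCos S γ := fun n =>
    exists_lt_of_lt_ciSup (sub_lt_self _ (by positivity))
  choose u hu using ex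
  have hpi := Real.pi_pos
  have cau : CauchySeq u := by
    refine cauchySeq_of_le_tendsto_0 (fun n : ℕ => √(2 * Real.pi ^ 2 * (1 / ((n : ℝ) + 2)))) ?_ ?_
    · intro n k N hn hk
      apply Real.le_sqrt_of_sq_le
      have mono : ∀ j : ℕ, N ≤ j → M - M * (1 / ((N : ℝ) + 2)) ≤ sumCos S (u j) := by
        intro j hj
        refine le_trans ?_ (hu j).le
        rw [mul_one_div]
        have : (N : ℝ) ≤ j := by exact_mod_cast hj
        gcongr
      -- Uniform convexity: two near-maximizers at a definite angle would have a sum of norm well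
      -- below `2`, hence too small a value. The bound forces `dist ^ 2 ≤ 2π²δ`.
      have h := add_sumCos_le S hM0.le hM (u n) (u k) one_pos one_pos
      have h1 := mono n hn
      have h2 := mono k hk
      set δ := 1 / ((N : ℝ) + 2)
      have hδ : δ < 1 := by
        rw [div_lt_one (by positivity)]
        linarith [(Nat.cast_nonneg N : (0 : ℝ) ≤ N)]
      have h3 : M * (2 - 2 * δ) ≤ M * √(1 ^ 2 + 1 ^ 2 + 2 * 1 * 1 * Real.cos (dist (u n) (u k))) := by
        linarith
      have h4 := le_of_mul_le_mul_left h3 hM0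
      have h6 : (2 - 2 * δ) ^ 2 ≤ 1 ^ 2 + 1 ^ 2 + 2 * 1 * 1 * Real.cos (dist (u n) (u k)) := by
        refine (Real.le_sqrt' ?_).1 h4
        linarith
      have h7 := Real.cos_le_one_sub_mul_cos_sq (x := dist (u n) (u k))
        (by rw [abs_of_nonneg dist_nonneg]; exact dist_directions_le_pi _ _)
      have h8 : 2 / Real.pi ^ 2 * dist (u n) (u k) ^ 2 ≤ 4 * δ := by
        nlinarith [sq_nonneg δ]
      rw [div_mul_eq_mul_div, div_le_iff₀ (by positivity)] at h8
      linarith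
    · have h := (tendsto_one_div_add_two).const_mul (2 * Real.pi ^ 2)
      have h2 := (Real.continuous_sqrt.tendsto _).comp h
      rwa [mul_zero, Real.sqrt_zero] at h2
  obtain ⟨γ, hγ⟩ := cauchySeq_tendsto_of_complete cau
  refine ⟨γ, fun ζ => (hM ζ).trans ?_⟩
  have t1 := ((continuous_sumCos S).tendsto γ).comp hγ
  have t2 : Tendsto (fun n : ℕ => M - M * (1 / ((n : ℝ) + 2))) atTop (𝓝 (M - M * 0)) :=
    (tendsto_one_div_add_two.const_mul M).const_sub M
  rw [mul_zero, sub_zero] at t2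
  refine le_of_tendsto_of_tendsto' t2 t1 fun n => ?_
  rw [mul_one_div]
  exact (hu n).le

/-- The first variation at a maximum of `sumCos S`. -/
lemma sumCos_le_mul_cos {S : Finset (GeodesicFrom x)} {γ : SpaceOfDirections x}
    (hγ : ∀ ζ, sumCos S ζ ≤ sumCos S γ) (hpos : 0 < sumCos S γ) (η : SpaceOfDirections x) :
    sumCos S η ≤ sumCos S γ * Real.cos (dist γ η) := by
  set M := sumCos S γ
  set F := sumCos S η
  have key : ∀ β : ℝ, 0 < β → F ≤ M * (Real.cos (dist γ η) + β / 2) := by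
    intro β hβ
    have h := add_sumCos_le S hpos.le hγ γ η one_pos hβ
    have h0 : 0 ≤ (1 : ℝ) ^ 2 + β ^ 2 + 2 * 1 * β * Real.cos (dist γ η) := by
      nlinarith [Real.neg_one_le_cos (dist γ η), sq_nonneg (1 - β)]
    -- This is `√t ≤ (1 + t) / 2`, the tangent line of the root at `1`.
    have h1 : √((1 : ℝ) ^ 2 + β ^ 2 + 2 * 1 * β * Real.cos (dist γ η)) ≤
        1 + β * Real.cos (dist γ η) + β ^ 2 / 2 := by
      have := Real.sq_sqrt h0
      generalize √((1 : ℝ) ^ 2 + β ^ 2 + 2 * 1 * β * Real.cos (dist γ η)) = t at this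
      nlinarith [sq_nonneg (t - 1)]
    have h2 := h.trans (mul_le_mul_of_nonneg_left h1 hpos.le)
    change 1 * M + β * F ≤ _ at h2
    refine le_of_mul_le_mul_left ?_ hβ
    nlinarith
  have lim : Tendsto (fun β : ℝ => M * (Real.cos (dist γ η) + β / 2)) (𝓝[>] 0)
      (𝓝 (M * (Real.cos (dist γ η) + 0 / 2))) :=
    Tendsto.mono_left (Continuous.tendsto (by fun_prop) 0) nhdsWithin_le_nhds
  rw [zero_div, add_zero] at lim
  exact ge_of_tendsto lim (eventually_mem_nhdsWithin.mono key)

/-- A set of directions at pairwise angles at most `π/2` lies in a ball of radius less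
than `π/2`, quantitatively. -/
lemma exists_central_direction {m : ℕ} (hm : 0 < m)
    (hDir : ∀ Δ : Set (SpaceOfDirections x),
      (∀ γ ∈ Δ, ∀ η ∈ Δ, γ ≠ η → Real.pi / 3 ≤ dist γ η) → Δ.encard ≤ m)
    {D : Set (GeodesicFrom x)} (hne : D.Nonempty)
    (hD : ∀ γ ∈ D, ∀ η ∈ D, angle γ η ≤ Real.pi / 2) :
    ∃ γ : SpaceOfDirections x, ∀ v ∈ D, 1 / (2 * (m : ℝ)) ≤ Real.cos (dist γ v) := by
  have hpi := Real.pi_pos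
  let sep : Set (GeodesicFrom x) → Prop := fun T => T.Pairwise fun γ η => Real.pi / 3 ≤ angle γ η
  obtain ⟨T, hT⟩ := zorn_subset {T | T ⊆ D ∧ sep T} fun c hc hchain =>
    ⟨⋃₀ c, ⟨sUnion_subset fun t ht => (hc ht).1,
      (pairwise_sUnion hchain.directedOn).2 fun t ht => (hc ht).2⟩,
      fun t ht => subset_sUnion_of_mem ht⟩
  obtain ⟨hTD, hTsep⟩ := hT.prop
  have dist_coe : ∀ γ η : GeodesicFrom x,
      dist (γ : SpaceOfDirections x) (η : SpaceOfDirections x) = angle γ η := fun γ η =>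
    UniformSpace.Completion.dist_eq γ η
  have inj : InjOn (fun γ : GeodesicFrom x => (γ : SpaceOfDirections x)) T := by
    intro γ hγ η hη h
    by_contra hne
    have h1 := hTsep hγ hη hne
    have h2 : dist (γ : SpaceOfDirections x) (η : SpaceOfDirections x) = 0 := dist_eq_zero.2 h
    rw [dist_coe] at h2
    linarith
  have hcard : T.encard ≤ m := by
    rw [← inj.encard_image]
    apply hDir
    rintro _ ⟨γ, hγ, rfl⟩ _ ⟨η, hη, rfl⟩ hne
    rw [dist_coe]
    exact hTsep hγ hη fun h => hne (by rw [h])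
  have hfin : T.Finite := finite_of_encard_le_coe hcard
  set S := hfin.toFinset with hS
  have hScard : (S.card : ℝ) ≤ m := by
    rw [hfin.encard_eq_coe_toFinset_card] at hcard
    exact_mod_cast hcard
  -- By maximality some member of `T` is within `π/3` of `v`, contributing at least `1/2`; the other
  -- terms are nonnegative because the angles are at most `π/2`.
  have half : ∀ v ∈ D, 1 / 2 ≤ sumCos S v := by
    intro v hv
    have ex : ∃ w ∈ T, angle v w ≤ Real.pi / 3 := by
      by_contra! hcon
      have hvT : v ∉ T := fun h => by
        have := hcon v h
        rw [angle_self] at this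
        linarith
      refine hvT (hT.le_of_ge ⟨insert_subset hv hTD, ?_⟩ (subset_insert v T) (mem_insert v T))
      refine pairwise_insert.2 ⟨hTsep, fun w hw _ => ?_⟩
      exact ⟨(hcon w hw).le, by rw [angle_comm]; exact (hcon w hw).le⟩
    obtain ⟨w, hw, hvw⟩ := ex
    calc (1 : ℝ) / 2 = Real.cos (Real.pi / 3) := Real.cos_pi_div_three.symm
      _ ≤ Real.cos (dist (v : SpaceOfDirections x) w) := by
        rw [dist_coe]
        exact Real.cos_le_cos_of_nonneg_of_le_pi (angle_nonneg v w) (by linarith) hvw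
      _ ≤ _ := Finset.single_le_sum
        (f := fun w : GeodesicFrom x => Real.cos (dist (v : SpaceOfDirections x) w))
        (fun i hi => by
          rw [dist_coe]
          have hiD := hTD (hfin.mem_toFinset.1 hi)
          exact Real.cos_nonneg_of_neg_pi_div_two_le_of_le
            (by linarith [angle_nonneg v i]) (hD v hv i hiD))
        (hfin.mem_toFinset.2 hw)
  obtain ⟨v₀, hv₀⟩ := hne
  have hv₀' := half v₀ hv₀
  obtain ⟨γ, hγ⟩ := exists_max_sumCos S ⟨v₀, by linarith⟩
  have hpos : 0 < sumCos S γ := by linarith [hγ v₀]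
  refine ⟨γ, fun v hv => ?_⟩
  have h1 := half v hv
  have h2 := sumCos_le_mul_cos hγ hpos v
  have h3 := (sumCos_le_card S γ).trans hScard
  have hm' : (0 : ℝ) < m := by exact_mod_cast hm
  have hc : 0 < Real.cos (dist γ (v : SpaceOfDirections x)) :=
    pos_of_mul_pos_right (by linarith) hpos.le
  rw [div_le_iff₀ (by positivity)]
  nlinarith

end Barycenter

/-! ### Projections to directions and their separation -/

section Projections

/-- In the plane, projecting the points with polar coordinates `(r, α)` and `(s, β)` to the axis
does not increase distance, and opening the angle between them to `θ` only moves them apart. -/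
lemma sq_mul_cos_sub_le {r s α β θ : ℝ} (hr : 0 ≤ r) (hs : 0 ≤ s) (hθ : θ ≤ Real.pi)
    (h : |α - β| ≤ θ) :
    (r * Real.cos α - s * Real.cos β) ^ 2 ≤ r ^ 2 + s ^ 2 - 2 * (r * s * Real.cos θ) := by
  have h1 : Real.cos θ ≤ Real.cos (α - β) := by
    rw [← Real.cos_abs (α - β)]
    exact Real.cos_le_cos_of_nonneg_of_le_pi (abs_nonneg _) hθ h
  have h2 := mul_le_mul_of_nonneg_left h1 (mul_nonneg hr hs)
  rw [Real.cos_sub] at h2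
  have e1 := Real.sin_sq_add_cos_sq α
  have e2 := Real.sin_sq_add_cos_sq β
  have e3 : r ^ 2 * (Real.sin α ^ 2 + Real.cos α ^ 2) = r ^ 2 := by rw [e1, mul_one]
  have e4 : s ^ 2 * (Real.sin β ^ 2 + Real.cos β ^ 2) = s ^ 2 := by rw [e2, mul_one]
  nlinarith [sq_nonneg (r * Real.sin α - s * Real.sin β)]

variable {X : Type*} [MetricSpace X] [CATZeroSpace X]

lemma sub_dist_sq_le_dir {x y z : X} (hy : y ≠ x) (hz : z ≠ x) :
    dist x y ^ 2 + dist x z ^ 2 - dist y z ^ 2 ≤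
      2 * dist x y * dist x z * Real.cos (dist (dir x y hy) (dir x z hz)) := by
  have h := sub_dist_sq_le (geodesicTo x y hy) (geodesicTo x z hz) (s := 1) (t := 1) one_pos one_pos
  rw [geodesicTo_one, geodesicTo_one] at h
  unfold dir
  rw [UniformSpace.Completion.dist_eq]
  exact h

lemma projLog_self {x : X} (γ : SpaceOfDirections x) : projLog γ x = 0 := dif_pos rfl

lemma projLog_of_ne {x y : X} (γ : SpaceOfDirections x) (h : y ≠ x) :
    projLog γ y = dist x y * Real.cos (dist γ (dir x y h)) := dif_neg h

lemma abs_projLog_le {x : X} (γ : SpaceOfDirections x) (y : X) : |projLog γ y| ≤ dist x y := by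
  by_cases h : y = x
  · subst h
    simp [projLog_self]
  · rw [projLog_of_ne γ h, abs_mul, abs_of_nonneg dist_nonneg]
    exact mul_le_of_le_one_right dist_nonneg (Real.abs_cos_le_one _)

/-- The logarithm at `x` does not increase distances, by the CAT(0) law of cosines, and neither does
the projection of the tangent cone to a direction, by the triangle inequality for angles. -/
lemma abs_projLog_sub_le {x : X} (γ : SpaceOfDirections x) (y z : X) :
    |projLog γ y - projLog γ z| ≤ dist y z := by
  by_cases hy : y = x
  · subst hy
    rw [projLog_self, zero_sub, abs_neg]
    exact abs_projLog_le γ z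
  by_cases hz : z = x
  · subst hz
    rw [projLog_self, sub_zero, dist_comm]
    exact abs_projLog_le γ y
  refine abs_le_of_sq_le_sq ?_ dist_nonneg
  rw [projLog_of_ne γ hy, projLog_of_ne γ hz]
  have h1 := sub_dist_sq_le_dir hy hz
  have h2 := sq_mul_cos_sub_le (r := dist x y) (s := dist x z) (α := dist γ (dir x y hy))
    (β := dist γ (dir x z hz)) dist_nonneg dist_nonneg
    (dist_directions_le_pi (dir x y hy) (dir x z hz))
    (by rw [dist_comm γ, dist_comm γ]; exact abs_dist_sub_le _ _ γ)
  linarith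

lemma lipschitzWith_projLog {x : X} (γ : SpaceOfDirections x) : LipschitzWith 1 (projLog γ) :=
  LipschitzWith.of_dist_le_mul fun y z => by
    rw [NNReal.coe_one, one_mul, Real.dist_eq]
    exact abs_projLog_sub_le γ y z

lemma volume_hullProj_le {x : X} (γ : SpaceOfDirections x) (S : Set X) :
    volume (hullProj γ S) ≤ Metric.ediam S := by
  refine (Real.volume_le_diam _).trans ?_
  unfold hullProj
  rw [closedConvexHull_eq_closure_convexHull, Metric.ediam_closure, convexHull_ediam]
  simpa using (lipschitzWith_projLog γ).ediam_image_le S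

lemma hullProj_mono {x : X} (γ : SpaceOfDirections x) {S T : Set X} (h : S ⊆ T) :
    hullProj γ S ⊆ hullProj γ T :=
  (closedConvexHull ℝ).monotone (image_mono h)

/-- The length of the projection grows if a point is added below it. -/
lemma volume_hullProj_add_le {x : X} (γ : SpaceOfDirections x) {S T : Set X} (hST : S ⊆ T)
    (hS : S.Nonempty) {p : X} (hp : p ∈ T) {c : ℝ}
    (h : ∀ y ∈ S, projLog γ p + c ≤ projLog γ y) :
    volume (hullProj γ S) + ENNReal.ofReal c ≤ volume (hullProj γ T) := by
  obtain ⟨q, hq⟩ := hS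
  have h1 : hullProj γ S ⊆ Ici (projLog γ p + c) :=
    closedConvexHull_min (by rintro _ ⟨y, hy, rfl⟩; exact h y hy) (convex_Ici _) isClosed_Ici
  have hmem : ∀ y ∈ T, projLog γ y ∈ hullProj γ T := fun y hy =>
    subset_closedConvexHull (mem_image_of_mem _ hy)
  have h2 : Ico (projLog γ p) (projLog γ p + c) ⊆ hullProj γ T := fun r hr =>
    convex_closedConvexHull.ordConnected.out (hmem p hp) (hmem q (hST hq))
      ⟨hr.1, hr.2.le.trans (h q hq)⟩
  have hdisj : Disjoint (hullProj γ S) (Ico (projLog γ p) (projLog γ p + c)) :=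
    disjoint_left.2 fun r hr hr' => not_lt.2 (h1 hr) hr'.2
  calc _ = volume (hullProj γ S ∪ Ico (projLog γ p) (projLog γ p + c)) := by
        rw [measure_union hdisj measurableSet_Ico, Real.volume_Ico, add_sub_cancel_left]
    _ ≤ _ := measure_mono (union_subset (hullProj_mono γ hST) h2)

lemma two_mul_sin_half_le {ε β : ℝ} (hε0 : 0 < ε) (hε1 : ε ≤ 1) (hβ0 : 0 ≤ β)
    (hβ : β ≤ 2 * Real.arcsin (ε / 2)) : 2 * Real.sin (β / 2) ≤ ε := by
  have h := Real.sin_le_sin_of_le_of_le_pi_div_two (x := β / 2) (y := Real.arcsin (ε / 2))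
    (by linarith [Real.pi_pos]) (Real.arcsin_le_pi_div_two _) (by linarith)
  rw [Real.sin_arcsin (by linarith) (by linarith)] at h
  linarith

lemma two_mul_arcsin_half_le {ε : ℝ} (hε1 : ε ≤ 1) :
    2 * Real.arcsin (ε / 2) ≤ Real.pi / 2 := by
  have : Real.arcsin (ε / 2) ≤ Real.pi / 4 := by
    refine (Real.arcsin_le_iff_le_sin' ⟨by linarith [Real.pi_pos], by linarith [Real.pi_pos]⟩).2 ?_
    rw [Real.sin_pi_div_four]
    have : (1 : ℝ) ≤ √2 := Real.one_le_sqrt.2 one_le_two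
    linarith
  linarith

lemma lt_pi_div_two_of_cos_pos {θ : ℝ} (h1 : θ ≤ Real.pi) (h : 0 < Real.cos θ) :
    θ < Real.pi / 2 := by
  by_contra! hc
  exact absurd h (not_lt.2 (Real.cos_nonpos_of_pi_div_two_le_of_le hc (by linarith [Real.pi_pos])))

/-- If `y` lies from `p` in a direction close to `γ` and `x` in a direction almost opposite to
`γ`, then the projections from `x` in the directions close to that of `p` separate `p` and `y`. -/
lemma projLog_add_le {ε : ℝ} (hε0 : 0 < ε) (hε1 : ε ≤ 1) {p x y : X} (hx : x ≠ p) (hy : y ≠ p)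
    {γ : SpaceOfDirections p} (hγ : 3 * ε ≤ Real.cos (dist γ (dir p y hy)))
    (hopp : Real.pi - 2 * Real.arcsin (ε / 2) ≤ dist (dir p x hx) γ)
    {η : SpaceOfDirections x} (hη : dist η (dir x p hx.symm) < 2 * Real.arcsin (ε / 2)) :
    projLog η p + ε * dist p y ≤ projLog η y := by
  have hpi := Real.pi_pos
  set δ := 2 * Real.arcsin (ε / 2) with hδ
  have hδ2 : δ ≤ Real.pi / 2 := two_mul_arcsin_half_le hε1
  have hδ0 : 0 ≤ δ := dist_nonneg.trans hη.le
  set a := dist p x with ha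
  set D := dist p y with hD
  have ha0 : 0 < a := dist_pos.2 hx.symm
  have hD0 : 0 < D := dist_pos.2 hy.symm
  set θ := dist γ (dir p y hy) with hθ
  set φ := dist (dir p x hx) (dir p y hy) with hφ
  have hθ0 : 0 ≤ θ := dist_nonneg
  have hθ2 : θ < Real.pi / 2 :=
    lt_pi_div_two_of_cos_pos (dist_directions_le_pi _ _) (by linarith)
  have hφ1 : Real.pi - (θ + δ) ≤ φ := by
    have := dist_triangle_right (dir p x hx) γ (dir p y hy)
    linarith
  -- Shifting `θ` by `δ` changes its cosine by at most `2 sin (δ / 2) ≤ ε`, which costs one of the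
  -- three `ε` in `hγ`.
  have hcosφ : Real.cos φ ≤ -(2 * ε) := by
    have h1 := Real.cos_le_cos_of_nonneg_of_le_pi (by linarith) (dist_directions_le_pi _ _) hφ1
    rw [Real.cos_pi_sub] at h1
    have h2 := Real.cos_sub_cos θ (θ + δ)
    have h3 : (θ - (θ + δ)) / 2 = -(δ / 2) := by ring
    rw [h3, Real.sin_neg] at h2
    have h4 := two_mul_sin_half_le hε0 hε1 hδ0 le_rfl
    have h5 : 0 ≤ Real.sin (δ / 2) := Real.sin_nonneg_of_nonneg_of_le_pi (by linarith) (by linarith)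
    have h6 := Real.sin_le_one ((θ + (θ + δ)) / 2)
    nlinarith
  have law1 : a ^ 2 + D ^ 2 - dist x y ^ 2 ≤ 2 * a * D * Real.cos φ := sub_dist_sq_le_dir hx hy
  have law1' : a ^ 2 + D ^ 2 + 4 * ε * (a * D) ≤ dist x y ^ 2 := by
    have := mul_le_mul_of_nonneg_left hcosφ (mul_pos ha0 hD0).le
    linarith
  have hyx : y ≠ x := by
    rintro rfl
    rw [dist_self] at law1'
    have : 0 < a ^ 2 + D ^ 2 + 4 * ε * (a * D) := by positivity
    linarith
  set Y := dist x y with hY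
  have hY0 : 0 < Y := dist_pos.2 hyx.symm
  have law2 := sub_dist_sq_le_dir hx.symm hyx
  rw [dist_comm x p, ← ha, ← hY, ← hD] at law2
  rw [projLog_of_ne η hx.symm, projLog_of_ne η hyx, dist_comm x p, ← ha, ← hY]
  set α := dist (dir x p hx.symm) (dir x y hyx) with hα
  set β := dist η (dir x p hx.symm) with hβ
  set ψ := dist η (dir x y hyx) with hψ
  have hβ0 : 0 ≤ β := dist_nonneg
  have hα0 : 0 ≤ α := dist_nonneg
  -- The law of cosines at `p` bounds `Y` from below; inserted into the one at `x`, it gives the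
  -- separation along the exact direction of `p`.
  have hu : 2 * ε * D ≤ Y * Real.cos α - a := by
    have : a * (2 * (2 * ε * D)) ≤ a * (2 * (Y * Real.cos α - a)) := by linarith
    linarith [le_of_mul_le_mul_left this ha0]
  have hcosα : 0 < Real.cos α := by
    have : 0 < Y * Real.cos α := by
      have : 0 < 2 * ε * D := by positivity
      linarith
    exact pos_of_mul_pos_right this hY0.le
  have hα2 := lt_pi_div_two_of_cos_pos (dist_directions_le_pi _ _) hcosα
  have hsinα : 0 ≤ Real.sin α := Real.sin_nonneg_of_nonneg_of_le_pi hα0 (by linarith)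
  have hψ1 : ψ ≤ α + β := by
    have := dist_triangle η (dir x p hx.symm) (dir x y hyx)
    linarith
  have hcosψ := Real.cos_le_cos_of_nonneg_of_le_pi (dist_nonneg : 0 ≤ ψ) (by linarith) hψ1
  rw [Real.cos_add] at hcosψ
  have hcosψ' := mul_le_mul_of_nonneg_left hcosψ hY0.le
  set u := Y * Real.cos α - a with hu_def
  set v := Y * Real.sin α with hv_def
  -- `(u, v)` is the planar vector from `p` to `y` in a model with the angle `α` at `x`. Replacing
  -- the direction of `p` by `η` amounts at worst to a rotation by `β`, which displaces this vector
  -- by at most `2 sin (β / 2) * D ≤ ε * D`, leaving `ε * D` of the separation.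
  have huv : u ^ 2 + v ^ 2 ≤ D ^ 2 := by
    have e := Real.sin_sq_add_cos_sq α
    have e2 : Y ^ 2 * (Real.sin α ^ 2 + Real.cos α ^ 2) = Y ^ 2 := by rw [e, mul_one]
    rw [hu_def, hv_def]
    linarith
  set S := Real.sin (β / 2)
  set C := Real.cos (β / 2)
  have hS0 : 0 ≤ S := Real.sin_nonneg_of_nonneg_of_le_pi (by linarith) (by linarith)
  have hS1 : 2 * S ≤ ε := two_mul_sin_half_le hε0 hε1 hβ0 hη.le
  have hSC : S ^ 2 + C ^ 2 = 1 := Real.sin_sq_add_cos_sq _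
  have hcosβ : Real.cos β = 1 - 2 * S ^ 2 := by
    have := Real.cos_sq' (β / 2)
    have h2 := Real.cos_two_mul (β / 2)
    rw [mul_div_cancel₀ _ two_ne_zero] at h2
    rw [h2, this]
    ring
  have hsinβ : Real.sin β = 2 * S * C := by
    have h2 := Real.sin_two_mul (β / 2)
    rwa [mul_div_cancel₀ _ two_ne_zero] at h2
  have hw : u * S + v * C ≤ D := by
    refine le_of_sq_le_sq ?_ hD0.le
    nlinarith [sq_nonneg (u * C - v * S)]
  have h1 : 2 * S * (u * S + v * C) ≤ ε * D := by
    calc _ ≤ 2 * S * D := by gcongr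
      _ ≤ _ := by gcongr
  have h2 : Y * (Real.cos α * Real.cos β - Real.sin α * Real.sin β) - a * Real.cos β
      = u - 2 * S * (u * S + v * C) := by
    rw [hcosβ, hsinβ, hu_def, hv_def]
    ring
  linarith

end Projections

/-! ### Averaging the projected lengths -/

section Widths

variable {X : Type*} [MetricSpace X] [CATZeroSpace X]

lemma dist_dir_le_cmpAngle {x y z : X} (hy : y ≠ x) (hz : z ≠ x) :
    dist (dir x y hy) (dir x z hz) ≤ cmpAngle y x z := by
  have h := angle_le_cmpAngle (geodesicTo x y hy) (geodesicTo x z hz) (s := 1) (t := 1)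
    one_pos one_pos
  rw [geodesicTo_one, geodesicTo_one] at h
  unfold dir
  rw [UniformSpace.Completion.dist_eq]
  exact h

/-- The angle is dominated by the comparison angle, which is continuous in the endpoint and vanishes
when the endpoints coincide. -/
lemma continuous_dir (z : X) : Continuous fun x : {x : X // x ≠ z} => dir z x.1 x.2 := by
  refine continuous_iff_continuousAt.2 fun x => tendsto_iff_dist_tendsto_zero.2 ?_
  have hx : 0 < dist z x.1 := dist_pos.2 x.2.symm
  have h : Tendsto (fun y : {x : X // x ≠ z} => cmpAngle y.1 z x.1) (𝓝 x)
      (𝓝 (cmpAngle x.1 z x.1)) := by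
    unfold cmpAngle
    refine (Real.continuous_arccos.tendsto _).comp ?_
    refine ContinuousAt.div (by fun_prop) (by fun_prop) (by positivity)
  have h0 : cmpAngle x.1 z x.1 = 0 := by
    unfold cmpAngle
    rw [Real.arccos_eq_zero, dist_self, le_div_iff₀ (by positivity)]
    apply le_of_eq
    ring
  rw [h0] at h
  exact squeeze_zero (fun _ => dist_nonneg) (fun y => dist_dir_le_cmpAngle y.2 x.2) h

lemma measurableSet_oppositeCone [MeasurableSpace X] [BorelSpace X] (ε σ : ℝ) {z : X}
    (γ : SpaceOfDirections z) : MeasurableSet (oppositeCone ε σ γ) := by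
  have e : oppositeCone ε σ γ = Subtype.val '' {x : {x : X // x ≠ z} | dist z x.1 < σ ∧
      Real.pi - 2 * Real.arcsin (ε / 2) ≤ dist (dir z x.1 x.2) γ} := by
    ext x
    simp [oppositeCone]
  have hm : MeasurableSet {x : X | x ≠ z} := (measurableSet_singleton z).compl
  have hc := continuous_dir z
  have h1 : IsOpen {x : {x : X // x ≠ z} | dist z x.1 < σ} :=
    isOpen_lt (by fun_prop) (by fun_prop)
  have h2 : IsClosed {x : {x : X // x ≠ z} |
      Real.pi - 2 * Real.arcsin (ε / 2) ≤ dist (dir z x.1 x.2) γ} :=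
    isClosed_le (by fun_prop) (by fun_prop)
  rw [e]
  exact hm.subtype_image (h1.measurableSet.inter h2.measurableSet)

/-- A set `S` which from `p` is seen under small angles lies around a central direction. -/
lemma exists_central_direction_of_dist_le {p : X} {m : ℕ} (hm : 0 < m)
    (hDir : ∀ Δ : Set (SpaceOfDirections p),
      (∀ γ ∈ Δ, ∀ η ∈ Δ, γ ≠ η → Real.pi / 3 ≤ dist γ η) → Δ.encard ≤ m)
    {S : Set X} (hS : S.Nonempty) (hp : ∀ y ∈ S, y ≠ p)
    (h : ∀ y ∈ S, ∀ z ∈ S, dist y z ≤ max (dist p y) (dist p z)) :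
    ∃ γ : SpaceOfDirections p, ∀ (y : X) (hy : y ≠ p), y ∈ S →
      1 / (2 * (m : ℝ)) ≤ Real.cos (dist γ (dir p y hy)) := by
  obtain ⟨q, hq⟩ := hS
  obtain ⟨γ, hγ⟩ := exists_central_direction hm hDir
    (D := {v | ∃ (y : X) (hy : y ≠ p), y ∈ S ∧ geodesicTo p y hy = v})
    ⟨_, q, hp q hq, hq, rfl⟩ (by
      rintro _ ⟨y, hy, hyS, rfl⟩ _ ⟨z, hz, hzS, rfl⟩
      have h1 : 0 < dist p y := dist_pos.2 hy.symm
      have h2 : 0 < dist p z := dist_pos.2 hz.symm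
      have e : dist (dir p y hy) (dir p z hz) = angle (geodesicTo p y hy) (geodesicTo p z hz) :=
        UniformSpace.Completion.dist_eq _ _
      rw [← e]
      refine (lt_pi_div_two_of_cos_pos (dist_directions_le_pi _ _) ?_).le
      -- Since `dist y z` is at most the longer of the two sides from `p`, the left side here is
      -- positive, and hence so is the cosine.
      have h3 := sub_dist_sq_le_dir hy hz
      have h4 : 0 < dist p y ^ 2 + dist p z ^ 2 - dist y z ^ 2 := by
        rcases le_max_iff.1 (h y hyS z hzS) with h5 | h5
        · nlinarith [dist_nonneg (x := y) (y := z), pow_le_pow_left₀ dist_nonneg h5 2]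
        · nlinarith [dist_nonneg (x := y) (y := z), pow_le_pow_left₀ dist_nonneg h5 2]
      exact pos_of_mul_pos_right (h4.trans_le h3) (by positivity))
  exact ⟨γ, fun y hy hyS => hγ _ ⟨y, hy, hyS, rfl⟩⟩

/-- The average over the directions at `x` of the lengths of the projections of `S`. -/
noncomputable def widthAt (A : ∀ x : X, Measure (SpaceOfDirections x)) (S : Set X) (x : X) :
    ℝ≥0∞ :=
  (A x univ)⁻¹ * ∫⁻ γ, volume (hullProj γ S) ∂(A x)

variable {A : ∀ x : X, Measure (SpaceOfDirections x)}

lemma widthAt_mono {S T : Set X} (h : S ⊆ T) (x : X) : widthAt A S x ≤ widthAt A T x := by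
  unfold widthAt
  gcongr with γ
  exact hullProj_mono γ h

lemma widthAt_le (S : Set X) (x : X) : widthAt A S x ≤ Metric.ediam S := by
  unfold widthAt
  calc _ ≤ (A x univ)⁻¹ * ∫⁻ _, Metric.ediam S ∂(A x) := by
        gcongr with γ
        exact volume_hullProj_le γ S
    _ = ((A x univ)⁻¹ * A x univ) * Metric.ediam S := by
        rw [lintegral_const, mul_assoc, mul_comm (A x univ)]
    _ ≤ 1 * Metric.ediam S := by
        gcongr
        exact ENNReal.inv_mul_le_one _
    _ = _ := one_mul _

/-- The gain is `c` on `B` and nonnegative elsewhere. Only the indicator of `B` has to be measurable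
for the lower integral to split. -/
lemma widthAt_add_le {S T : Set X} (hST : S ⊆ T) {x : X} {B : Set (SpaceOfDirections x)}
    (hB : MeasurableSet B) {c a : ℝ≥0∞}
    (h : ∀ γ ∈ B, volume (hullProj γ S) + c ≤ volume (hullProj γ T))
    (ha : a ≤ A x B / A x univ) : widthAt A S x + c * a ≤ widthAt A T x := by
  have key : ∫⁻ γ, volume (hullProj γ S) ∂(A x) + c * A x B
      ≤ ∫⁻ γ, volume (hullProj γ T) ∂(A x) := by
    rw [← lintegral_indicator_const hB,
      ← lintegral_add_right _ (measurable_const.indicator hB)]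
    refine lintegral_mono fun γ => ?_
    by_cases hγ : γ ∈ B
    · simpa [hγ] using h γ hγ
    · simpa [hγ] using measure_mono (hullProj_mono γ hST)
  calc _ ≤ widthAt A S x + c * (A x B / A x univ) := by gcongr
    _ = (A x univ)⁻¹ * (∫⁻ γ, volume (hullProj γ S) ∂(A x) + c * A x B) := by
        rw [widthAt, mul_add, div_eq_mul_inv]
        ring
    _ ≤ _ := by
        unfold widthAt
        gcongr

variable [MeasurableSpace X]

lemma meanWidth_eq (Ω : Set X) (V : Measure X) (S : Set X) :
    meanWidth Ω A V S = (V Ω)⁻¹ * ∫⁻ x in Ω, widthAt A S x ∂V := rfl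

lemma meanWidth_mono (Ω : Set X) (V : Measure X) {S T : Set X} (h : S ⊆ T) :
    meanWidth Ω A V S ≤ meanWidth Ω A V T := by
  rw [meanWidth_eq, meanWidth_eq]
  gcongr with x
  exact widthAt_mono h x

lemma meanWidth_le_ediam (Ω : Set X) (V : Measure X) (S : Set X) :
    meanWidth Ω A V S ≤ Metric.ediam S := by
  rw [meanWidth_eq]
  calc _ ≤ (V Ω)⁻¹ * ∫⁻ _ in Ω, Metric.ediam S ∂V := by
        gcongr with x
        exact widthAt_le S x
    _ = ((V Ω)⁻¹ * V Ω) * Metric.ediam S := by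
        rw [setLIntegral_const, mul_assoc, mul_comm (V Ω)]
    _ ≤ 1 * Metric.ediam S := by
        gcongr
        exact ENNReal.inv_mul_le_one _
    _ = _ := one_mul _

/-- The same splitting over base points: `widthAt` need not be measurable, since the function added
to it is a constant on the measurable set `C`. -/
lemma meanWidth_add_le {Ω C : Set X} {V : Measure X} {S T : Set X} (hST : S ⊆ T)
    (hC : MeasurableSet C) (hCΩ : C ⊆ Ω) {c b : ℝ≥0∞}
    (h : ∀ x ∈ C, widthAt A S x + c ≤ widthAt A T x) (hb : b ≤ V C / V Ω) :
    meanWidth Ω A V S + c * b ≤ meanWidth Ω A V T := by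
  have key : ∫⁻ x in Ω, widthAt A S x ∂V + c * V C ≤ ∫⁻ x in Ω, widthAt A T x ∂V := by
    have e : V C = V.restrict Ω C := by
      rw [Measure.restrict_apply hC, inter_eq_self_of_subset_left hCΩ]
    rw [e, ← lintegral_indicator_const hC,
      ← lintegral_add_right _ (measurable_const.indicator hC)]
    refine lintegral_mono fun x => ?_
    by_cases hx : x ∈ C
    · simpa [hx] using h x hx
    · simpa [hx] using widthAt_mono hST x
  calc _ ≤ meanWidth Ω A V S + c * (V C / V Ω) := by gcongr
    _ = (V Ω)⁻¹ * (∫⁻ x in Ω, widthAt A S x ∂V + c * V C) := by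
        rw [meanWidth_eq, mul_add, div_eq_mul_inv]
        ring
    _ ≤ _ := by
        rw [meanWidth_eq]
        gcongr

/-- The mean width drops by a fixed proportion of `dist p q` when the point `p` is left for a set
`S ∋ q` of points which are closer to `q` than to `p`. -/
lemma meanWidth_drop [BorelSpace X] {Ω : Set X} {V : Measure X} {m : ℕ} (hm : 0 < m) {ε : ℝ}
    (hε : ε = 1 / (6 * (m : ℝ))) {a σ b : ℝ} (ha : 0 < a) (hσ : 0 < σ)
    (hDir : DirectionBound Ω m) (hArea : AreaRatio Ω ε a A) (hVol : VolumeRatio Ω ε σ b V)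
    {S T : Set X} (hST : S ⊆ T) {p q : X} (hq : q ∈ S) (hp : p ∈ T) (hball : Metric.ball p σ ⊆ Ω)
    (hqp : ∀ y ∈ S, dist q y ≤ dist p y)
    (hpair : ∀ y ∈ S, ∀ z ∈ S, dist y z ≤ max (dist p y) (dist p z)) :
    ENNReal.ofReal (a * b * ε / 2) * edist p q + meanWidth Ω A V S ≤ meanWidth Ω A V T := by
  by_cases hpq : p = q
  · rw [hpq, edist_self, mul_zero, zero_add]
    exact meanWidth_mono Ω V hST
  have hm1 : (1 : ℝ) ≤ m := by exact_mod_cast hm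
  have hε0 : 0 < ε := by rw [hε]; positivity
  have hε1 : ε ≤ 1 := by
    rw [hε, div_le_one (by positivity)]
    linarith
  have h3ε : 3 * ε = 1 / (2 * (m : ℝ)) := by
    rw [hε]
    field_simp
    norm_num
  -- The points of `S` are no farther from `q` than from `p`. This is the source of the factor `1/2`
  -- in the constant, and it keeps `S` away from `p`.
  have hd : ∀ y ∈ S, dist p q / 2 ≤ dist p y := fun y hy => by
    have h1 := dist_triangle_right p q y
    have h2 := hqp y hy
    linarith
  have hpq0 : 0 < dist p q := dist_pos.2 hpq
  have hne : ∀ y ∈ S, y ≠ p := fun y hy => by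
    rw [ne_comm, ← dist_pos]
    linarith [hd y hy]
  have hpΩ : p ∈ Ω := hball (Metric.mem_ball_self hσ)
  obtain ⟨γ, hγ⟩ := exists_central_direction_of_dist_le hm (hDir p hpΩ) ⟨q, hq⟩ hne hpair
  -- Here the `σ`-neighborhood is needed: the area ratio is available at every point of the cone,
  -- and restricting the integral to `Ω` loses none of it.
  have hCΩ : oppositeCone ε σ γ ⊆ Ω := by
    rintro x ⟨_, hx, _⟩
    exact hball (by rwa [Metric.mem_ball'])
  have h := meanWidth_add_le (A := A) hST (measurableSet_oppositeCone ε σ γ) hCΩ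
    (c := ENNReal.ofReal (ε * (dist p q / 2)) * ENNReal.ofReal a) (fun x hx => by
      have hxΩ := hCΩ hx
      obtain ⟨hxp, -, hopp⟩ := hx
      refine widthAt_add_le hST Metric.isOpen_ball.measurableSet (fun η hη => ?_)
        (hArea x hxΩ (dir x p hxp.symm))
      refine volume_hullProj_add_le η hST ⟨q, hq⟩ hp fun y hy => ?_
      have hsep := projLog_add_le hε0 hε1 hxp (hne y hy)
        (by rw [h3ε]; exact hγ y (hne y hy) hy) hopp (Metric.mem_ball.1 hη)
      have := mul_le_mul_of_nonneg_left (hd y hy) hε0.le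
      linarith) (hVol p hpΩ γ)
  refine le_of_eq_of_le ?_ h
  rw [add_comm, edist_dist, ← ENNReal.ofReal_mul' dist_nonneg, ← ENNReal.ofReal_mul (by positivity),
    ← ENNReal.ofReal_mul (by positivity)]
  congr 2
  ring

end Widths

/-! ### Length controlled by a decreasing functional -/

/-- A curve is rectifiable if its length can be charged to the drop of a function of the
parameter. -/
lemma eVariationOn_le_of_drop {T X : Type*} [LinearOrder T] [PseudoEMetricSpace X] (ξ : T → X)
    (W : T → ℝ≥0∞) {κ K : ℝ≥0∞} (hκ0 : κ ≠ 0) (hκ : κ ≠ ∞)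
    (h : ∀ s t, s ≤ t → κ * edist (ξ s) (ξ t) + W t ≤ W s) (hK : ∀ t, W t ≤ K) :
    eVariationOn ξ univ ≤ κ⁻¹ * K := by
  refine iSup_le fun ⟨n, u, hu, _⟩ => ?_
  have key : ∀ n, κ * ∑ i ∈ Finset.range n, edist (ξ (u (i + 1))) (ξ (u i)) + W (u n) ≤ W (u 0) := by
    intro n
    induction n with
    | zero => simp
    | succ n ih =>
      refine le_trans ?_ ih
      rw [Finset.sum_range_succ, mul_add, add_assoc, edist_comm]
      gcongr
      exact h _ _ (hu n.le_succ)
  rw [← ENNReal.mul_le_iff_le_inv hκ0 hκ]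
  exact le_self_add.trans ((key n).trans (hK _))

end SelfContractedCAT

theorem theorem5p1 {X : Type*} [MetricSpace X] [CompleteSpace X] [CATZeroSpace X]
    [MeasurableSpace X] [BorelSpace X]
    (Ω : Set X) (hΩ : Bornology.IsBounded Ω)
    (m : ℕ) (hm : 0 < m) (ε : ℝ) (hε : ε = 1 / (6 * (m : ℝ)))
    (a σ b : ℝ) (ha : 0 < a) (hσ : 0 < σ) (hb : 0 < b)
    (A : ∀ x : X, Measure (SpaceOfDirections x)) (V : Measure X)
    (hDir : DirectionBound Ω m) (hArea : AreaRatio Ω ε a A) (hVol : VolumeRatio Ω ε σ b V)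
    (ℓ : ℝ≥0∞) (hℓ : 0 < ℓ) (ξ : Set.Ico (0 : ℝ≥0∞) ℓ → X) (hξ : SelfContracted ξ)
    (hnhd : Metric.thickening σ (Set.range ξ) ⊆ Ω) :
    eVariationOn ξ Set.univ < ∞ ∧
      eVariationOn ξ Set.univ ≤
        ENNReal.ofReal (2 / (a * b * ε)) * meanWidth Ω A V (Set.range ξ) ∧
      ENNReal.ofReal (2 / (a * b * ε)) * meanWidth Ω A V (Set.range ξ) ≤
        ENNReal.ofReal (2 / (a * b * ε)) * Metric.ediam (Set.range ξ) := by
  have hm' : (0 : ℝ) < m := by exact_mod_cast hm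
  have hε0 : 0 < ε := by rw [hε]; positivity
  have hκ : 0 < a * b * ε / 2 := by positivity
  have hdiam : ENNReal.ofReal (2 / (a * b * ε)) * meanWidth Ω A V (Set.range ξ) ≤
      ENNReal.ofReal (2 / (a * b * ε)) * Metric.ediam (Set.range ξ) := by
    gcongr
    exact meanWidth_le_ediam Ω V _
  have hlen : eVariationOn ξ Set.univ ≤
      ENNReal.ofReal (2 / (a * b * ε)) * meanWidth Ω A V (Set.range ξ) := by
    have e : ENNReal.ofReal (2 / (a * b * ε)) = (ENNReal.ofReal (a * b * ε / 2))⁻¹ := by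
      rw [← ENNReal.ofReal_inv_of_pos hκ, inv_div]
    rw [e]
    refine eVariationOn_le_of_drop ξ (fun t => meanWidth Ω A V (ξ '' Set.Ici t))
      (ENNReal.ofReal_pos.2 hκ).ne' ENNReal.ofReal_ne_top (fun s t hst => ?_)
      (fun t => meanWidth_mono Ω V (Set.image_subset_range _ _))
    refine meanWidth_drop hm hε ha hσ hDir hArea hVol
      (Set.image_mono (Set.Ici_subset_Ici.2 hst)) (Set.mem_image_of_mem ξ Set.self_mem_Ici)
      (Set.mem_image_of_mem ξ Set.self_mem_Ici)
      ((Metric.ball_subset_thickening (Set.mem_range_self s) σ).trans hnhd) ?_ ?_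
    · rintro _ ⟨r, hr, rfl⟩
      exact hξ s t r hst hr
    · rintro _ ⟨r, hr, rfl⟩ _ ⟨r', hr', rfl⟩
      -- Self-contraction compares distances to the later of the two points, whence the maximum.
      rcases le_total r r' with h | h
      · exact (hξ s r r' (hst.trans hr) h).trans (le_max_right _ _)
      · rw [dist_comm (ξ r)]
        exact (hξ s r' r (hst.trans hr') h).trans (le_max_left _ _)
  refine ⟨hlen.trans_lt (hdiam.trans_lt (ENNReal.mul_lt_top ENNReal.ofReal_lt_top ?_)), hlen, hdiam⟩
  exact (Metric.isBounded_iff_ediam_ne_top.1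
    (hΩ.subset ((Metric.self_subset_thickening hσ _).trans hnhd))).lt_top
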